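/- Let $q$ be an odd prime power and let $\Pi_2(q^2)$ be the projective plane over $GF(q^2)$, whose points are the non-zero vectors of $GF(q^2)^3$ up to non-zero scalars. A pencil in $\Pi_2(q^2)$ is the set of all $q^2+1$ lines through some common point. A $k$-parc (pencil arc) with respect to a pencil is a set $\mathcal K$ of $k$ points such that (i) for each line $\Psi$ of the pencil, $\mathcal K\cap\Psi$ is an arc in $\Psi$, i.e. any two distinct points of it are independent; (ii) $\mathcal K\cap\Psi\cap\Psi'=\emptyset$ for any two distinct lines $\Psi,\Psi'$ of the pencil; and (iii) any three distinct points of $\mathcal K$ that are not all contained in a single line of the pencil are linearly independent (not collinear). A regular $(m,h)$-parc is a pencil arc for which $m$ lines of the pencil contain exactly $h$ points of $\mathcal K$ each and all other lines of the pencil contain no point of $\mathcal K$. Then the following exist in $\Pi_2(q^2)$: 1. a $(q^2+q)$-parc $\mathcal K$ with respect to some pencil, such that exactly two lines of the pencil contain exactly $q$ points of $\mathcal K$ and exactly $(q-1)/2$ lines of the pencil contain exactly $2q$ points of $\mathcal K$; 2. a regular $((q+1)/2,\,2q)$-parc; 3. a regular $(q,q)$-parc. -/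

import Mathlib

open scoped LinearAlgebra.Projectivization

namespace PencilArc

/-- The `r`-dimensional projective space over `F`: points are classes of non-zero
`(r+1)`-tuples up to non-zero scalars. -/
abbrev ProjSpace (r : ℕ) (F : Type*) [Field F] : Type _ := ℙ F (Fin (r + 1) → F)

variable {r : ℕ} {F : Type*} [Field F]

/-- The set of points of the projective subspace given by a linear subspace `W`;
its projective dimension is `finrank W - 1`. -/
def points (W : Submodule F (Fin (r + 1) → F)) : Set (ProjSpace r F) :=
  {x | x.submodule ≤ W}

/-- Any `t` (distinct) points of `S` are linearly independent. -/
def TIndependent (t : ℕ) (S : Set (ProjSpace r F)) : Prop :=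
  ∀ T : Finset (ProjSpace r F), (T : Set (ProjSpace r F)) ⊆ S → T.card = t →
    Projectivization.Independent (fun x : T => (x : ProjSpace r F))

/-- `S` is a `k`-arc in the projective subspace given by `W`: a set of `k` points of that
subspace such that any `finrank W` (that is, projective dimension plus one) of them are
independent. -/
def IsArcIn (W : Submodule F (Fin (r + 1) → F)) (k : ℕ) (S : Set (ProjSpace r F)) : Prop :=
  S ⊆ points W ∧ S.encard = k ∧ TIndependent (Module.finrank F W) S

/-- The pencil with vertex `L`: all hyperplanes containing `L`. -/
def pencil (L : Submodule F (Fin (r + 1) → F)) : Set (Submodule F (Fin (r + 1) → F)) :=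
  {H | Module.finrank F H = r ∧ L ≤ H}

/-- `K` is a pencil arc with respect to the pencil of hyperplanes through the subspace `L`
of projective dimension `r - 2`. -/
structure IsPencilArc (L : Submodule F (Fin (r + 1) → F)) (K : Set (ProjSpace r F)) : Prop where
  vertex : Module.finrank F L + 1 = r
  finite : K.Finite
  arc : ∀ H ∈ pencil L, IsArcIn H (K ∩ points H).ncard (K ∩ points H)
  disjoint : ∀ H ∈ pencil L, ∀ H' ∈ pencil L, H ≠ H' → K ∩ points H ∩ points H' = ∅
  indep : ∀ T : Finset (ProjSpace r F), (T : Set (ProjSpace r F)) ⊆ K → T.card = r + 1 →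
    (∀ H ∈ pencil L, ¬ (T : Set (ProjSpace r F)) ⊆ points H) →
    Projectivization.Independent (fun x : T => (x : ProjSpace r F))

/-- A `k`-parc: a pencil arc with `k` points. -/
def IsParc (k : ℕ) (L : Submodule F (Fin (r + 1) → F)) (K : Set (ProjSpace r F)) : Prop :=
  IsPencilArc L K ∧ K.encard = k

/-- A regular pencil arc, or `(m, h)`-parc: some `m` hyperplanes of the pencil contain exactly
`h` points of `K` each, and all the others contain none. -/
def IsRegularParc (m h : ℕ) (L : Submodule F (Fin (r + 1) → F)) (K : Set (ProjSpace r F)) :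
    Prop :=
  IsPencilArc L K ∧
    ∃ A : Set (Submodule F (Fin (r + 1) → F)), A ⊆ pencil L ∧ A.encard = m ∧
      (∀ H ∈ A, (K ∩ points H).encard = h) ∧
      ∀ H ∈ pencil L, H ∉ A → (K ∩ points H).encard = 0

end PencilArc

/-!
Write `F = k + k i` with `k` the subfield of order `q`. The affine points `(t, y)` of the plane over
`F` with `t ∈ k` then form an affine space of dimension three over `k`, with coordinates `t, u, v`
where `y = u + v i`; a vertical line `t = const` of the plane becomes a plane of this space, and three
points in distinct such planes that are collinear over `F` are collinear over `k`, since the slope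
`a + b i` of the line through them splits into its two coordinates.

So take a curve in the `(t, v)`-plane over `k`, no three of whose points with distinct `t` are
collinear, and let `K` be the `cylinder` over it in the direction of `u`. A transversal of the vertical
lines projects to a transversal in the `(t, v)`-plane, hence `K` is a pencil arc for the pencil of
vertical lines (`isPencilArc_cylinder`), and a vertical line meets `K` in `q` times as many points as
the corresponding line meets the curve (`encard_cylinder_inter_verticalLine`).

The curve is a conic, and the three sets of the theorem correspond to the three positions of the
common point at infinity of the vertical lines: on the conic for the parabola `v = t ^ 2`, external
for `v ^ 2 = n (t ^ 2 - 1)`, and internal for `v ^ 2 = n (t ^ 2 - n)`, where `n` is not a square. The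
last two conics have all their `q + 1` points in the affine plane (`sum_card_conic`), which determines
the number of their vertical secants (`card_secant_external`, `card_secant_internal`).
-/

namespace PencilArc

/-! ### Field extensions of degree two -/

/-- A field of order `q ^ 2` contains a copy of the field of order `q`, namely a Galois field, whose
degree over the prime field divides that of `F`. -/
theorem exists_finiteField_algHom_of_card_sq {q : ℕ} (hq : IsPrimePow q) {F : Type*} [Field F]
    (hF : Nat.card F = q ^ 2) :
    ∃ (k : Type) (_ : Field k) (_ : Fintype k), Fintype.card k = q ∧ Nonempty (k →+* F) := by
  obtain ⟨p, n, hp, hn, rfl⟩ := (isPrimePow_nat_iff _).1 hq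
  have : Fact p.Prime := ⟨hp⟩
  have : Finite F := Nat.finite_of_card_ne_zero (by simp [hF, hp.ne_zero])
  have : Fintype F := Fintype.ofFinite F
  have : CharP F p := charP_of_card_eq_prime_pow (f := n * 2)
    (by rw [← Nat.card_eq_fintype_card, hF, pow_mul])
  let _ : Algebra (ZMod p) F := ZMod.algebra F p
  have : Fintype (GaloisField p n) := Fintype.ofFinite _
  refine ⟨GaloisField p n, inferInstance, inferInstance, ?_, ?_⟩
  · rw [← Nat.card_eq_fintype_card, GaloisField.card p n hn.ne']
  · have h : Module.finrank (ZMod p) F = n * 2 := by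
      have := FiniteField.pow_finrank_eq_natCard p F
      rw [hF, ← pow_mul] at this
      exact Nat.pow_right_injective hp.two_le this
    obtain ⟨f⟩ := FiniteField.nonempty_algHom_of_finrank_dvd (F := ZMod p)
      (K := GaloisField p n) (L := F)
      (by rw [h, GaloisField.finrank p hn.ne']; exact dvd_mul_right _ _)
    exact ⟨f.toRingHom⟩

/-- An element of `F` outside the image of `k` is, together with `1`, linearly independent over
`k`. -/
theorem exists_linearIndependent_one {k F : Type*} [Field k] [Field F] [Fintype k]
    (σ : k →+* F) (h : Nat.card F ≠ Fintype.card k) :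
    ∃ i : F, ∀ a b : k, σ a + σ b * i = 0 → a = 0 ∧ b = 0 := by
  have hs : ¬ Function.Surjective σ := fun hs => h (by
    rw [← Nat.card_eq_fintype_card]
    exact (Nat.card_congr (Equiv.ofBijective σ ⟨σ.injective, hs⟩)).symm)
  simp only [Function.Surjective, not_forall, not_exists] at hs
  obtain ⟨i, hi⟩ := hs
  refine ⟨i, fun a b hab => ?_⟩
  have hb : b = 0 := by
    by_contra hb
    apply hi (-a / b)
    have : σ b ≠ 0 := (map_ne_zero σ).2 hb
    rw [map_div₀, map_neg]
    field_simp
    linear_combination -hab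
  subst hb
  simpa using hab

/-! ### Affine conics -/

section Conic

variable {k : Type*} [Field k]

/-- The affine plane curve `{(t, v) | v ∈ D t}`, described by its vertical fibres `D t`, has no three
collinear points with distinct abscissae `t`; collinearity is written without division, as equality
of two slopes. Points of the same fibre are not restricted. -/
def NoTransversalTriple (D : k → Finset k) : Prop :=
  ∀ t₁ t₂ t₃ : k, t₁ ≠ t₂ → t₁ ≠ t₃ → t₂ ≠ t₃ → ∀ v₁ ∈ D t₁, ∀ v₂ ∈ D t₂, ∀ v₃ ∈ D t₃,
    (v₂ - v₁) * (t₃ - t₁) ≠ (v₃ - v₁) * (t₂ - t₁)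

theorem noTransversalTriple_parabola : NoTransversalTriple fun t : k => {t ^ 2} := by
  intro t₁ t₂ t₃ h12 h13 h23 v₁ h₁ v₂ h₂ v₃ h₃ h
  simp only [Finset.mem_singleton] at h₁ h₂ h₃
  subst h₁ h₂ h₃
  have : (t₂ - t₁) * (t₃ - t₁) * (t₂ - t₃) = 0 := by linear_combination h
  simp [sub_eq_zero, h12.symm, h13.symm, h23] at this

theorem ringChar_ne_two_of_two_ne_zero (h : (2 : k) ≠ 0) : ringChar k ≠ 2 := by
  intro h'
  exact h (by simpa [h'] using ringChar.Nat.cast_ringChar (R := k))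

variable [Fintype k] [DecidableEq k]

/-- The fibre over `t` of the affine conic `v ^ 2 = n * (t ^ 2 - c)`. For `n` not a square this conic
has no points at infinity. -/
def conic (n c t : k) : Finset k := {v | v ^ 2 = n * (t ^ 2 - c)}

theorem mem_conic {n c t v : k} : v ∈ conic n c t ↔ v ^ 2 = n * (t ^ 2 - c) := by
  simp [conic]

theorem noTransversalTriple_conic {n : k} (hn : ¬ IsSquare n) (c : k) :
    NoTransversalTriple (conic n c) := by
  intro t₁ t₂ t₃ h12 h13 h23 v₁ h₁ v₂ h₂ v₃ h₃ h
  rw [mem_conic] at h₁ h₂ h₃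
  have hd : t₂ - t₁ ≠ 0 := sub_ne_zero.2 h12.symm
  have he : t₃ - t₁ ≠ 0 := sub_ne_zero.2 h13.symm
  have hf : t₂ - t₃ ≠ 0 := sub_ne_zero.2 h23
  -- If the points lie on a line of slope `a`, then comparing the three equations gives `a ^ 2 = n`.
  obtain ⟨a, ha⟩ : ∃ a, v₂ - v₁ = a * (t₂ - t₁) := ⟨(v₂ - v₁) / (t₂ - t₁), by field_simp⟩
  have hb : v₃ - v₁ = a * (t₃ - t₁) := mul_right_cancel₀ hd (by rw [← h, ha]; ring)
  obtain rfl : v₂ = v₁ + a * (t₂ - t₁) := by linear_combination ha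
  obtain rfl : v₃ = v₁ + a * (t₃ - t₁) := by linear_combination hb
  have e2 : 2 * v₁ * a + a ^ 2 * (t₂ - t₁) = n * (t₂ + t₁) :=
    mul_right_cancel₀ hd (by linear_combination h₂ - h₁)
  have e3 : 2 * v₁ * a + a ^ 2 * (t₃ - t₁) = n * (t₃ + t₁) :=
    mul_right_cancel₀ he (by linear_combination h₃ - h₁)
  exact hn ⟨a, mul_right_cancel₀ hf (by linear_combination e3 - e2)⟩

/-- The hyperbola `t ^ 2 - s ^ 2 = c` has `|k| - 1` affine points: it is parametrized by the unit
`u = t - s`, with `t + s = c / u`. -/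
theorem card_hyperbola (h2 : (2 : k) ≠ 0) {c : k} (hc : c ≠ 0) :
    ∑ t : k, ({s | s ^ 2 = t ^ 2 - c} : Finset k).card = Fintype.card k - 1 := by
  rw [← Finset.card_sigma, ← Fintype.card_units, ← Finset.card_univ]
  refine Finset.card_bij' (fun x hx => Units.mk0 (x.1 - x.2) ?_)
    (fun u _ => ⟨(c / u + u) / 2, (c / u - u) / 2⟩) ?_ ?_ ?_ ?_
  · intro h
    simp only [Finset.mem_sigma, Finset.mem_univ, Finset.mem_filter, true_and] at hx
    exact hc (by linear_combination (x.1 + x.2) * h + hx)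
  · simp
  · intro u _
    have := u.ne_zero
    simp only [Finset.mem_sigma, Finset.mem_univ, Finset.mem_filter, true_and]
    field_simp
    ring
  · rintro ⟨t, s⟩ hx
    simp only [Finset.mem_sigma, Finset.mem_univ, Finset.mem_filter, true_and] at hx
    have : t - s ≠ 0 := fun h => hc (by linear_combination (t + s) * h + hx)
    have h3 : c / (t - s) = t + s := by
      field_simp
      linear_combination hx
    simp only [Units.val_mk0, h3, Sigma.mk.injEq, heq_eq_eq]
    constructor <;> field_simp <;> ring
  · intro u _
    ext
    simp only [Units.val_mk0]
    field_simp
    ring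

/-- With the quadratic character `χ`, the fibre over `t` has `1 + χ (n * (t ^ 2 - c))` points, and
`χ n = -1`, so the count is the reflection about `|k|` of that of the hyperbola
`s ^ 2 = t ^ 2 - c`. -/
theorem sum_card_conic (h2 : (2 : k) ≠ 0) {n c : k} (hn : ¬ IsSquare n) (hc : c ≠ 0) :
    ∑ t : k, (conic n c t).card = Fintype.card k + 1 := by
  have hch := ringChar_ne_two_of_two_ne_zero h2
  have key (a : k) : ((({s | s ^ 2 = a} : Finset k).card : ℕ) : ℤ) = quadraticChar k a + 1 := by
    rw [← quadraticChar_card_sqrts hch a]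
    congr 2
    ext; simp
  have h1 := congrArg (Nat.cast : ℕ → ℤ) (card_hyperbola h2 hc)
  rw [Nat.cast_sub Fintype.card_pos] at h1
  push_cast at h1
  simp only [key, Finset.sum_add_distrib] at h1
  have hn' : quadraticChar k n = -1 := quadraticChar_neg_one_iff_not_isSquare.2 hn
  zify
  simp only [conic, key, map_mul, hn', Finset.sum_add_distrib, neg_one_mul, Finset.sum_neg_distrib]
  simp at h1 ⊢
  linarith

theorem card_conic_eq (h2 : (2 : k) ≠ 0) {n c t : k} (hn : n ≠ 0) (ht : t ^ 2 ≠ c) :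
    (conic n c t).card = 0 ∨ (conic n c t).card = 2 := by
  have hch := ringChar_ne_two_of_two_ne_zero h2
  have key : (((conic n c t).card : ℕ) : ℤ) = quadraticChar k (n * (t ^ 2 - c)) + 1 := by
    rw [← quadraticChar_card_sqrts hch]
    congr 2
    ext; simp [mem_conic]
  rcases quadraticChar_dichotomy (mul_ne_zero hn (sub_ne_zero.2 ht)) with h | h <;>
    rw [h] at key <;> omega

theorem card_conic_of_sq_eq {n c t : k} (ht : t ^ 2 = c) : (conic n c t).card = 1 := by
  rw [Finset.card_eq_one]
  exact ⟨0, by ext; simp [mem_conic, ht]⟩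

/-- The point at infinity of the vertical lines is internal to `v ^ 2 = n * (t ^ 2 - n)`: no vertical
line is tangent. -/
theorem card_secant_internal (h2 : (2 : k) ≠ 0) {n : k} (hn : ¬ IsSquare n) :
    ({t | (conic n n t).card = 2} : Finset k).card = (Fintype.card k + 1) / 2 ∧
    ∀ t, (conic n n t).card = 0 ∨ (conic n n t).card = 2 := by
  have h0 : n ≠ 0 := by rintro rfl; exact hn (IsSquare.zero)
  have hd : ∀ t, (conic n n t).card = 0 ∨ (conic n n t).card = 2 := fun t =>
    card_conic_eq h2 h0 fun h => hn ⟨t, by rw [← h, sq]⟩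
  refine ⟨?_, hd⟩
  have := sum_card_conic h2 hn h0
  have e : ∀ t, (conic n n t).card = if (conic n n t).card = 2 then 2 else 0 := fun t => by
    rcases hd t with h | h <;> simp [h]
  rw [Finset.sum_congr rfl fun t _ => e t, ← Finset.sum_filter, Finset.sum_const, smul_eq_mul] at this
  omega

/-- The point at infinity of the vertical lines is external to `v ^ 2 = n * (t ^ 2 - 1)`: the vertical
lines `t = 1` and `t = -1` are tangent. -/
theorem card_secant_external (h2 : (2 : k) ≠ 0) {n : k} (hn : ¬ IsSquare n) :
    ({t | (conic n 1 t).card = 1} : Finset k).card = 2 ∧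
    ({t | (conic n 1 t).card = 2} : Finset k).card = (Fintype.card k - 1) / 2 := by
  have h0 : n ≠ 0 := by rintro rfl; exact hn (IsSquare.zero)
  have hd : ∀ t, t ^ 2 ≠ 1 → (conic n 1 t).card = 0 ∨ (conic n 1 t).card = 2 := fun t =>
    card_conic_eq h2 h0
  have h1 : ∀ t, (conic n 1 t).card = 1 ↔ t ^ 2 = 1 := fun t =>
    ⟨fun h => by by_contra h'; rcases hd t h' with h' | h' <;> omega, card_conic_of_sq_eq⟩
  have c1 : ({t | (conic n 1 t).card = 1} : Finset k).card = 2 := by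
    have : (1 : k) ≠ -1 := fun h => h2 (by linear_combination h)
    rw [← Finset.card_pair this]
    congr 1
    ext t
    simp [h1, sq, mul_self_eq_one_iff]
  refine ⟨c1, ?_⟩
  have := sum_card_conic h2 hn one_ne_zero
  have e : ∀ t, (conic n 1 t).card = (if (conic n 1 t).card = 2 then 2 else 0) +
      if (conic n 1 t).card = 1 then 1 else 0 := fun t => by
    by_cases h : t ^ 2 = 1
    · simp [(h1 t).2 h]
    · rcases hd t h with h | h <;> simp [h]
  rw [Finset.sum_congr rfl fun t _ => e t, Finset.sum_add_distrib, ← Finset.sum_filter,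
    ← Finset.sum_filter, Finset.sum_const, Finset.sum_const, smul_eq_mul, smul_eq_mul, c1] at this
  omega
end Conic

/-! ### The pencil of vertical lines -/

section Plane

variable {F : Type*} [Field F]

/-- The affine point `(x, y)`, that is the projective point `(x : y : 1)`. -/
def affinePoint (x y : F) : ProjSpace 2 F :=
  Projectivization.mk F ![x, y, 1] fun h => one_ne_zero (congrFun h 2)

theorem affinePoint_inj {x y x' y' : F} :
    affinePoint x y = affinePoint x' y' ↔ x = x' ∧ y = y' := by
  refine ⟨fun h => ?_, by rintro ⟨rfl, rfl⟩; rfl⟩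
  obtain ⟨a, ha⟩ := (Projectivization.mk_eq_mk_iff' _ _ _ _ _).1 h
  have h0 := congrFun ha 0
  have h1 := congrFun ha 1
  have h2 := congrFun ha 2
  simp at h0 h1 h2
  subst h2
  simp at h0 h1
  exact ⟨h0.symm, h1.symm⟩

/-- The point at infinity `(0 : 1 : 0)` common to all vertical lines, as a linear subspace. -/
def verticalVertex (F : Type*) [Field F] : Submodule F (Fin (2 + 1) → F) :=
  Submodule.span F {![0, 1, 0]}

/-- The line joining `(0 : 1 : 0)` and `(x : 0 : 1)`, as a linear subspace. -/
def verticalLine (x : F) : Submodule F (Fin (2 + 1) → F) :=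
  Submodule.span F {![0, 1, 0], ![x, 0, 1]}

theorem finrank_verticalVertex : Module.finrank F (verticalVertex F) = 1 :=
  finrank_span_singleton fun h => one_ne_zero (congrFun h 1)

theorem verticalVertex_le (x : F) : verticalVertex F ≤ verticalLine x :=
  Submodule.span_mono (by simp)

theorem finrank_verticalLine (x : F) : Module.finrank F (verticalLine x) = 2 := by
  have h : LinearIndependent F ![![0, 1, 0], ![x, 0, 1]] := by
    rw [LinearIndependent.pair_iff]
    intro a b hab
    have h1 := congrFun hab 1
    have h2 := congrFun hab 2
    simp at h1 h2
    exact ⟨h1, h2⟩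
  have := finrank_span_eq_card h
  rwa [Matrix.range_cons, Matrix.range_cons, Matrix.range_empty, Set.union_empty] at this

theorem verticalLine_mem_pencil (x : F) : verticalLine x ∈ pencil (verticalVertex F) :=
  ⟨finrank_verticalLine x, verticalVertex_le x⟩

theorem mem_points_affinePoint {x y : F} {H : Submodule F (Fin (2 + 1) → F)} :
    affinePoint x y ∈ points H ↔ ![x, y, 1] ∈ H := by
  simp [points, affinePoint, Projectivization.submodule_mk]

theorem affinePoint_mem_verticalLine {x x' y : F} :
    affinePoint x y ∈ points (verticalLine x') ↔ x = x' := by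
  rw [mem_points_affinePoint, verticalLine, Submodule.mem_span_pair]
  constructor
  · rintro ⟨a, b, h⟩
    have h0 := congrFun h 0
    have h2 := congrFun h 2
    simp at h0 h2
    subst h2
    simpa using h0.symm
  · rintro rfl
    exact ⟨y, 1, by ext j; fin_cases j <;> simp⟩

theorem verticalLine_injective : Function.Injective (verticalLine (F := F)) := fun x x' h =>
  affinePoint_mem_verticalLine.1 (h ▸ affinePoint_mem_verticalLine.2 rfl :
    affinePoint x 0 ∈ points (verticalLine x'))

theorem eq_verticalLine {x y : F} {H : Submodule F (Fin (2 + 1) → F)}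
    (hH : H ∈ pencil (verticalVertex F)) (h : affinePoint x y ∈ points H) :
    H = verticalLine x := by
  rw [mem_points_affinePoint] at h
  refine (Submodule.eq_of_le_of_finrank_eq ?_ ?_).symm
  · have h1 : ![0, 1, 0] ∈ H := hH.2 (Submodule.mem_span_singleton_self _)
    refine Submodule.span_le.2 ?_
    rintro w (rfl | rfl)
    · exact h1
    · have := H.sub_mem h (H.smul_mem y h1)
      rwa [show ![x, y, 1] - y • ![0, 1, 0] = ![x, 0, 1] by ext j; fin_cases j <;> simp] at this
  · rw [finrank_verticalLine, hH.1]

/-- Passing from an independent family to the independence of a finset, the form used in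
`TIndependent` and `IsPencilArc`. -/
theorem independent_of_subset_range {r : ℕ} {ι : Type*} {f : ι → ProjSpace r F}
    (hf : Projectivization.Independent f) (T : Finset (ProjSpace r F))
    (hT : (T : Set (ProjSpace r F)) ⊆ Set.range f) :
    Projectivization.Independent (fun x : T => (x : ProjSpace r F)) := by
  choose g hg using fun x : T => hT x.2
  have hinj : Function.Injective g := fun x y h => Subtype.ext (by rw [← hg, ← hg y, h])
  rw [Projectivization.independent_iff] at hf ⊢
  convert hf.comp g hinj using 1
  ext x : 1
  simp [hg]

theorem tIndependent_two {r : ℕ} (S : Set (ProjSpace r F)) : TIndependent 2 S := by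
  classical
  intro T _ hT
  obtain ⟨a, b, hab, rfl⟩ := Finset.card_eq_two.1 hT
  exact independent_of_subset_range ((Projectivization.independent_pair_iff_ne a b).2 hab) _
    (by simp [Set.insert_subset_iff])

theorem independent_affinePoint {x₁ y₁ x₂ y₂ x₃ y₃ : F}
    (h : (y₂ - y₁) * (x₃ - x₁) ≠ (y₃ - y₁) * (x₂ - x₁)) :
    Projectivization.Independent ![affinePoint x₁ y₁, affinePoint x₂ y₂, affinePoint x₃ y₃] := by
  have hl : LinearIndependent F ![![x₁, y₁, 1], ![x₂, y₂, 1], ![x₃, y₃, 1]] := by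
    have hdet : IsUnit (Matrix.of ![![x₁, y₁, 1], ![x₂, y₂, 1], ![x₃, y₃, 1]]) := by
      rw [Matrix.isUnit_iff_isUnit_det, isUnit_iff_ne_zero, Matrix.det_fin_three]
      intro h0
      simp at h0
      exact h (by linear_combination -h0)
    exact Matrix.linearIndependent_rows_iff_isUnit.2 hdet
  convert Projectivization.Independent.mk _ (fun j h0 => hl.ne_zero j h0) hl using 1
  ext j : 1
  fin_cases j <;> rfl

/-! ### Cylinders over affine curves -/

section Cylinder

variable {k : Type*} [Field k] (σ : k →+* F) (i : F) (D : k → Finset k)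

/-- The set of affine points `(t, u + v i)` with `t`, `u` in the subfield `k`, embedded by `σ`, and
`(t, v)` on the plane curve with fibres `D t`. When `1` and `i` are independent over `k`, this is the
cylinder over the curve in the affine space of the triples `(t, u, v)` over `k`, with generators in
the direction of `u`. -/
def cylinder : Set (ProjSpace 2 F) :=
  {P | ∃ t u, ∃ v ∈ D t, affinePoint (σ t) (σ u + σ v * i) = P}

variable {σ i D}

theorem eq_verticalLine_of_cylinder_inter_nonempty {H : Submodule F (Fin (2 + 1) → F)}
    (hH : H ∈ pencil (verticalVertex F)) (h : (cylinder σ i D ∩ points H).Nonempty) :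
    ∃ t, H = verticalLine (σ t) := by
  obtain ⟨_, ⟨t, u, v, hv, rfl⟩, h⟩ := h
  exact ⟨t, eq_verticalLine hH h⟩

theorem coords_injective (hi : ∀ a b : k, σ a + σ b * i = 0 → a = 0 ∧ b = 0) :
    Function.Injective fun p : k × k => σ p.1 + σ p.2 * i := by
  rintro ⟨u, v⟩ ⟨u', v'⟩ h
  simp only at h
  obtain ⟨h1, h2⟩ := hi (u - u') (v - v') (by simp only [map_sub]; linear_combination h)
  rw [sub_eq_zero.1 h1, sub_eq_zero.1 h2]

variable [Fintype k]

theorem cylinder_inter_verticalLine (t : k) :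
    cylinder σ i D ∩ points (verticalLine (σ t)) =
      (fun p : k × k => affinePoint (σ t) (σ p.1 + σ p.2 * i)) ''
        ((Finset.univ ×ˢ D t : Finset (k × k)) : Set (k × k)) := by
  ext P
  constructor
  · rintro ⟨⟨t', u, v, hv, rfl⟩, h⟩
    obtain rfl := σ.injective (affinePoint_mem_verticalLine.1 h)
    exact ⟨(u, v), by simpa using hv, rfl⟩
  · rintro ⟨⟨u, v⟩, h, rfl⟩
    exact ⟨⟨t, u, v, by simpa using h, rfl⟩, affinePoint_mem_verticalLine.2 rfl⟩

theorem encard_cylinder_inter_verticalLine (hi : ∀ a b : k, σ a + σ b * i = 0 → a = 0 ∧ b = 0)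
    (t : k) : (cylinder σ i D ∩ points (verticalLine (σ t))).encard =
      (Fintype.card k * (D t).card : ℕ) := by
  rw [cylinder_inter_verticalLine, Function.Injective.encard_image, Set.encard_coe_eq_coe_finsetCard,
    Finset.card_product, Finset.card_univ]
  exact fun p p' h => coords_injective hi (affinePoint_inj.1 h).2

theorem encard_cylinder (hi : ∀ a b : k, σ a + σ b * i = 0 → a = 0 ∧ b = 0) :
    (cylinder σ i D).encard = (Fintype.card k * ∑ t, (D t).card : ℕ) := by
  have : cylinder σ i D = (fun p : k × (Σ _ : k, k) =>
      affinePoint (σ p.2.1) (σ p.1 + σ p.2.2 * i)) ''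
      ((Finset.univ ×ˢ Finset.univ.sigma D : Finset (k × (Σ _ : k, k))) : Set _) := by
    ext P
    constructor
    · rintro ⟨t, u, v, hv, rfl⟩
      exact ⟨(u, ⟨t, v⟩), by simpa using hv, rfl⟩
    · rintro ⟨⟨u, ⟨t, v⟩⟩, h, rfl⟩
      exact ⟨t, u, v, by simpa using h, rfl⟩
  rw [this, Function.Injective.encard_image, Set.encard_coe_eq_coe_finsetCard,
    Finset.card_product, Finset.card_univ, Finset.card_sigma]
  rintro ⟨u, t, v⟩ ⟨u', t', v'⟩ h
  obtain ⟨h1, h2⟩ := affinePoint_inj.1 h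
  obtain rfl := σ.injective h1
  obtain ⟨rfl, rfl⟩ := Prod.mk.inj (coords_injective hi (a₁ := (u, v)) (a₂ := (u', v')) h2)
  rfl

/-- Three collinear points of the cylinder on distinct vertical lines have collinear projections
`(t, v)`, since the coefficient of `i` in the collinearity equation over `F` is the collinearity
equation of the projections over `k`. -/
theorem isPencilArc_cylinder (hi : ∀ a b : k, σ a + σ b * i = 0 → a = 0 ∧ b = 0)
    (hD : NoTransversalTriple D) : IsPencilArc (verticalVertex F) (cylinder σ i D) := by
  have hfin : (cylinder σ i D).Finite := Set.finite_of_encard_eq_coe (encard_cylinder hi)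
  have hsing {a b : k} (h : a ≠ b) : σ a - σ b ≠ 0 := sub_ne_zero.2 (σ.injective.ne h)
  refine ⟨by rw [finrank_verticalVertex], hfin, ?_, ?_, ?_⟩
  · intro H hH
    refine ⟨Set.inter_subset_right, ?_, ?_⟩
    · exact (hfin.subset Set.inter_subset_left).cast_ncard_eq.symm
    · rw [hH.1]
      exact tIndependent_two _
  · intro H hH H' hH' hne
    refine Set.eq_empty_of_forall_notMem ?_
    rintro _ ⟨⟨⟨t, u, v, hv, rfl⟩, h⟩, h'⟩
    exact hne ((eq_verticalLine hH h).trans (eq_verticalLine hH' h').symm)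
  · classical
    intro T hT hcard hpen
    obtain ⟨P₁, P₂, P₃, h12, h13, h23, rfl⟩ := Finset.card_eq_three.1 hcard
    obtain ⟨t₁, u₁, v₁, hv₁, rfl⟩ := hT (by simp : P₁ ∈ _)
    obtain ⟨t₂, u₂, v₂, hv₂, rfl⟩ := hT (by simp : P₂ ∈ _)
    obtain ⟨t₃, u₃, v₃, hv₃, rfl⟩ := hT (by simp : P₃ ∈ _)
    refine independent_of_subset_range (independent_affinePoint (x₁ := σ t₁)
      (y₁ := σ u₁ + σ v₁ * i) (x₂ := σ t₂) (y₂ := σ u₂ + σ v₂ * i) (x₃ := σ t₃)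
      (y₃ := σ u₃ + σ v₃ * i) ?_) _ (by simp [Set.insert_subset_iff])
    rw [Ne, affinePoint_inj] at h12 h13 h23
    intro h
    -- If exactly two of the points share a vertical line, the third is off the line joining them.
    by_cases e12 : t₁ = t₂
    · subst e12
      by_cases e13 : t₁ = t₃
      · subst e13
        exact hpen _ (verticalLine_mem_pencil (σ t₁))
          (by simp [Set.insert_subset_iff, affinePoint_mem_verticalLine])
      · rw [sub_self, mul_zero] at h
        rcases mul_eq_zero.1 h with h | h
        · exact h12 ⟨rfl, (sub_eq_zero.1 h).symm⟩
        · exact hsing (Ne.symm e13) h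
    by_cases e13 : t₁ = t₃
    · subst e13
      rw [sub_self, mul_zero] at h
      rcases mul_eq_zero.1 h.symm with h | h
      · exact h13 ⟨rfl, (sub_eq_zero.1 h).symm⟩
      · exact hsing (Ne.symm e12) h
    by_cases e23 : t₂ = t₃
    · subst e23
      exact h23 ⟨rfl, sub_left_injective (mul_right_cancel₀ (hsing (Ne.symm e12)) h)⟩
    · refine hD t₁ t₂ t₃ e12 e13 e23 v₁ hv₁ v₂ hv₂ v₃ hv₃ (sub_eq_zero.1 (hi
        ((u₂ - u₁) * (t₃ - t₁) - (u₃ - u₁) * (t₂ - t₁)) _ ?_).2)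
      simp only [map_sub, map_mul]
      linear_combination h

/-- The assumption `m ≠ 0` excludes the lines of the pencil that are not of the form
`verticalLine (σ t)`: these miss the cylinder. -/
theorem encard_setOf_pencil (hi : ∀ a b : k, σ a + σ b * i = 0 → a = 0 ∧ b = 0)
    {m : ℕ} (hm : m ≠ 0) :
    {l ∈ pencil (verticalVertex F) |
      (cylinder σ i D ∩ points l).encard = (Fintype.card k * m : ℕ)}.encard =
      (({t | (D t).card = m} : Finset k).card : ℕ) := by
  rw [← Set.encard_coe_eq_coe_finsetCard,
    ← (verticalLine_injective.comp σ.injective).encard_image]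
  congr 1
  ext H
  constructor
  · rintro ⟨hH, h⟩
    have hne : (cylinder σ i D ∩ points H).Nonempty := by
      rw [← Set.encard_pos, h]
      exact_mod_cast Nat.pos_of_ne_zero (mul_ne_zero Fintype.card_ne_zero hm)
    obtain ⟨t, rfl⟩ := eq_verticalLine_of_cylinder_inter_nonempty hH hne
    rw [encard_cylinder_inter_verticalLine hi] at h
    exact ⟨t, by
      simpa using Nat.eq_of_mul_eq_mul_left Fintype.card_pos (Nat.cast_injective h), rfl⟩
  · rintro ⟨t, ht, rfl⟩
    refine ⟨verticalLine_mem_pencil _, ?_⟩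
    simp only [Function.comp, encard_cylinder_inter_verticalLine hi]
    simp at ht
    rw [ht]

theorem isRegularParc_cylinder (hi : ∀ a b : k, σ a + σ b * i = 0 → a = 0 ∧ b = 0)
    (hD : NoTransversalTriple D) {m : ℕ} (hm : m ≠ 0)
    (hDm : ∀ t, (D t).card = 0 ∨ (D t).card = m) :
    IsRegularParc ({t | (D t).card = m} : Finset k).card (Fintype.card k * m)
      (verticalVertex F) (cylinder σ i D) := by
  refine ⟨isPencilArc_cylinder hi hD, _, Set.sep_subset _ _, encard_setOf_pencil hi hm,
    fun H hH => hH.2, fun H hH hHA => ?_⟩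
  by_contra h
  obtain ⟨t, rfl⟩ := eq_verticalLine_of_cylinder_inter_nonempty hH (Set.encard_ne_zero.1 h)
  rw [encard_cylinder_inter_verticalLine hi] at h
  rcases hDm t with h' | h'
  · exact h (by simp [h'])
  · exact hHA ⟨hH, by rw [encard_cylinder_inter_verticalLine hi, h']⟩

end Cylinder

end Plane

end PencilArc

theorem theorem5p2 (q : ℕ) (hq : IsPrimePow q) (hodd : Odd q)
    (F : Type*) [Field F] (hF : Nat.card F = q ^ 2) :
    (∃ (L : Submodule F (Fin (2 + 1) → F)) (K : Set (PencilArc.ProjSpace 2 F)),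
      PencilArc.IsParc (q ^ 2 + q) L K ∧
      {l ∈ PencilArc.pencil L | (K ∩ PencilArc.points l).encard = q}.encard = 2 ∧
      {l ∈ PencilArc.pencil L | (K ∩ PencilArc.points l).encard = (2 * q : ℕ)}.encard
        = ((q - 1) / 2 : ℕ)) ∧
    (∃ (L : Submodule F (Fin (2 + 1) → F)) (K : Set (PencilArc.ProjSpace 2 F)),
      PencilArc.IsRegularParc ((q + 1) / 2) (2 * q) L K) ∧
    (∃ (L : Submodule F (Fin (2 + 1) → F)) (K : Set (PencilArc.ProjSpace 2 F)),
      PencilArc.IsRegularParc q q L K) := by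
  classical
  open PencilArc in
  obtain ⟨k, _, _, hk, ⟨σ⟩⟩ := exists_finiteField_algHom_of_card_sq hq hF
  have hq1 := hq.one_lt
  obtain ⟨i, hi⟩ := exists_linearIndependent_one σ (by rw [hF, hk]; nlinarith)
  have hch : ringChar k ≠ 2 := fun h => by
    have := FiniteField.even_card_of_char_two h
    rw [hk] at this
    exact Nat.not_even_iff_odd.2 hodd (Nat.even_iff.2 this)
  have h2 : (2 : k) ≠ 0 := Ring.two_ne_zero hch
  obtain ⟨n, hn⟩ := FiniteField.exists_nonsquare hch
  subst hk
  refine ⟨⟨verticalVertex F, cylinder σ i (conic n 1), ⟨?_, ?_⟩, ?_, ?_⟩,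
    ⟨verticalVertex F, cylinder σ i (conic n n), ?_⟩,
    ⟨verticalVertex F, cylinder σ i fun t => {t ^ 2}, ?_⟩⟩
  · exact isPencilArc_cylinder hi (noTransversalTriple_conic hn 1)
  · rw [encard_cylinder hi, sum_card_conic h2 hn one_ne_zero]
    congr 1
    ring
  · have := encard_setOf_pencil (D := conic n 1) hi one_ne_zero
    rw [mul_one, (card_secant_external h2 hn).1] at this
    exact this
  · rw [mul_comm 2, encard_setOf_pencil hi two_ne_zero, (card_secant_external h2 hn).2]
  · rw [mul_comm 2, ← (card_secant_internal h2 hn).1]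
    exact isRegularParc_cylinder hi (noTransversalTriple_conic hn n) two_ne_zero
      (card_secant_internal h2 hn).2
  · have := isRegularParc_cylinder (D := fun t => {t ^ 2}) hi noTransversalTriple_parabola
      one_ne_zero (by simp)
    simpa using this
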